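/- Let $(\Gamma_t)_{t\ge 0}$ be a standard Gamma process on a probability space $(\Omega,P)$: $\Gamma_0=0$ a.s., the increments are independent, $\Gamma_t-\Gamma_s$ has the Gamma law with shape $t-s$ and rate $1$ for $0\le s<t$, and almost all paths are nondecreasing and right-continuous. For a function $f\ge 0$ on $[0,\infty)$ that is integrable on every $[0,t]$ and not almost everywhere zero, write $$\lambda_t f=\int_0^t f(x)\,dx,\qquad \Gamma_t f=\int_{(0,t]} f\,d\Gamma \ \text{ (pathwise Lebesgue--Stieltjes integral)},$$ $$v_t(f)=\frac{\lambda_t(f^2)}{(\lambda_t f)^2},\qquad b_t(f)=\frac{f(t)}{\lambda_t f},\qquad R_t(f)=\frac{\Gamma_t f}{\lambda_t f},$$ where the quotients are considered for all $t$ so large that $\lambda_tf>0$. Define the following classes of such functions $f$, all limits being taken as $t\to\infty$: * $\mathcal V$: $f$ is locally square integrable on $[0,\infty)$ and $v_t(f)\to 0$; * $\mathcal B$: $b_t(f)\to 0$; * $\mathrm{OD}$ (orderly divergence in probability): $\lambda_t f\to\infty$ and $R_t(f)\to 1$ in probability. **Lemma.** Each of the classes $\mathcal V$, $\mathcal B$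 and $\mathrm{OD}$ is closed under multiplication by constants $c>0$ and under sums: if $f,g$ belong to the class, so do $cf$ and $f+g$. The same holds for the subclass of those $f\in\mathcal B$ with $\lambda_t f\to\infty$. -/

import Mathlib

open Set Filter Topology MeasureTheory ProbabilityTheory
open scoped NNReal ENNReal

noncomputable section

namespace OrderlyDivergence

/-! ### Integrands on the half-line and their numerical characteristics

An integrand on `[0, ∞)` is a function `f : ℝ → ℝ` of which only the values on `[0, ∞)` matter. -/

/-- `λ_t f = ∫_0^t f(x) dx`. -/
def lam (f : ℝ → ℝ) (t : ℝ) : ℝ := ∫ x in Ioc 0 t, f x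

/-- `v_t = λ_t(f²) / (λ_t f)²`. -/
def vRatio (f : ℝ → ℝ) (t : ℝ) : ℝ := lam (fun x => f x ^ 2) t / lam f t ^ 2

/-- `b_t = f(t) / λ_t f`. -/
def bRatio (f : ℝ → ℝ) (t : ℝ) : ℝ := f t / lam f t

/-- Positive, locally integrable functions on `[0, ∞)` that are not almost everywhere zero
(so that division by `λ_t f` makes sense for all large `t`). -/
structure IsIntegrand (f : ℝ → ℝ) : Prop where
  nonneg : ∀ x, 0 ≤ x → 0 ≤ f x
  locallyIntegrable : ∀ t, IntegrableOn f (Ioc 0 t)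
  nontrivial : ∃ t, 0 < lam f t

/-- The integrands with `λ_t f → ∞`. -/
def Divergent : Set (ℝ → ℝ) := {f | IsIntegrand f ∧ Tendsto (lam f) atTop atTop}

/-- The class `𝒱`: locally square integrable integrands with `v_t → 0`. -/
def ClassV : Set (ℝ → ℝ) :=
  {f | IsIntegrand f ∧ (∀ t, IntegrableOn (fun x => f x ^ 2) (Ioc 0 t)) ∧
    Tendsto (vRatio f) atTop (𝓝 0)}

/-- The class `ℬ`: integrands with `b_t → 0`. -/
def ClassB : Set (ℝ → ℝ) := {f | IsIntegrand f ∧ Tendsto (bRatio f) atTop (𝓝 0)}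

/-! ### The Gamma process and the pathwise integral -/

/-- A nondecreasing right-continuous path. -/
def IsGoodPath (γ : ℝ≥0 → ℝ) : Prop :=
  Monotone γ ∧ ∀ t, ContinuousWithinAt γ (Ici t) t

/-- A good path, extended by the constant `γ 0` to the negative axis, as a Stieltjes function. -/
def pathStieltjes (γ : ℝ≥0 → ℝ) (h : IsGoodPath γ) : StieltjesFunction ℝ where
  toFun x := γ x.toNNReal
  mono' _ _ hxy := h.1 (Real.toNNReal_mono hxy)
  right_continuous' x :=
    (h.2 x.toNNReal).comp (continuous_real_toNNReal.continuousWithinAt)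
      (fun _ hy => Real.toNNReal_mono hy)

open Classical in
/-- The Lebesgue–Stieltjes measure `dγ` of a path, with mass `γ b - γ a` on `(a, b]` for
`0 ≤ a ≤ b`. (It is set to `0` on the null set of paths that are not good.) -/
def pathMeasure (γ : ℝ≥0 → ℝ) : Measure ℝ :=
  if h : IsGoodPath γ then (pathStieltjes γ h).measure else 0

/-- `Γ` is a standard Gamma process on `(Ω, P)`: it starts at `0`, has independent increments,
`Γ_t - Γ_s` has the Gamma law with shape `t - s` and rate `1` for `s < t`, and almost all its paths
are nondecreasing and right-continuous. In particular `Γ_1` is exponential with mean `1`. -/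
structure IsGammaProcess {Ω : Type*} [MeasurableSpace Ω] (P : Measure Ω) (Γ : ℝ≥0 → Ω → ℝ) :
    Prop where
  zero : ∀ᵐ ω ∂P, Γ 0 ω = 0
  indep : HasIndepIncrements Γ P
  law : ∀ s t : ℝ≥0, s < t →
    HasLaw (fun ω => Γ t ω - Γ s ω) (gammaMeasure ((t : ℝ) - (s : ℝ)) 1) P
  path : ∀ᵐ ω ∂P, IsGoodPath (fun t => Γ t ω)

/-- The pathwise Gamma integral `Γ_t f = ∫_0^t f dΓ`. -/
def gammaIntegral {Ω : Type*} (Γ : ℝ≥0 → Ω → ℝ) (f : ℝ → ℝ) (t : ℝ) (ω : Ω) : ℝ :=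
  ∫ x in Ioc 0 t, f x ∂(pathMeasure (fun s => Γ s ω))

/-- The class OD (orderly divergence in probability): integrands with `λ_t f → ∞` such that
`R_t = Γ_t f / λ_t f → 1` in probability as `t → ∞`. -/
def ClassOD {Ω : Type*} [MeasurableSpace Ω] (P : Measure Ω) (Γ : ℝ≥0 → Ω → ℝ) : Set (ℝ → ℝ) :=
  {f | f ∈ Divergent ∧
    TendstoInMeasure P (fun t ω => gammaIntegral Γ f t ω / lam f t) atTop (fun _ => (1 : ℝ))}

/-- Closedness of a class of functions under positive scaling and under sums. -/
def ClosedUnderScalingAndSums (C : Set (ℝ → ℝ)) : Prop :=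
  (∀ c : ℝ, 0 < c → ∀ f ∈ C, (fun x => c * f x) ∈ C) ∧
    ∀ f ∈ C, ∀ g ∈ C, (fun x => f x + g x) ∈ C

end OrderlyDivergence

end

open Set Filter Topology MeasureTheory ProbabilityTheory
open scoped NNReal ENNReal

namespace OrderlyDivergence

/-! ### Scaling and sums of integrands -/

section Integrands

variable {f g : ℝ → ℝ} {c t : ℝ}

/-! All the ratios are invariant under scaling, so sums carry the content. For `ClassV`, (f + g)² ≤
2f² + 2g² and λ_t(f + g) dominates λ_t f and λ_t g, so v_t(f + g) ≤ 2v_t(f) + 2v_t(g); similarly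
b_t(f + g) ≤ b_t(f) + b_t(g).

For `ClassOD`, R_t(f + g) is a.s. the average of R_t(f) and R_t(g) with weights λ_t f and λ_t g, so
it is within ε of 1 whenever both are. This needs Γ_t(f + g) = Γ_t f + Γ_t g a.s., hence pathwise
integrability of f and g. The law of the increments gives E Γ(a, b] = b - a, so dΓ has Lebesgue
intensity (`bind_restrict_pathMeasure`) and E ∫ |f| dΓ = ∫ |f| dx < ∞ (`ae_integrableOn`). -/

lemma lam_const_mul (c : ℝ) (f : ℝ → ℝ) (t : ℝ) : lam (fun x => c * f x) t = c * lam f t :=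
  integral_const_mul _ _

lemma lam_add (hf : IntegrableOn f (Ioc 0 t)) (hg : IntegrableOn g (Ioc 0 t)) :
    lam (fun x => f x + g x) t = lam f t + lam g t :=
  integral_add hf hg

lemma lam_le_lam (hf : IntegrableOn f (Ioc 0 t)) (hg : IntegrableOn g (Ioc 0 t))
    (h : ∀ x, f x ≤ g x) : lam f t ≤ lam g t :=
  setIntegral_mono hf hg h

lemma lam_sq_nonneg (f : ℝ → ℝ) (t : ℝ) : 0 ≤ lam (fun x => f x ^ 2) t :=
  integral_nonneg fun _ => sq_nonneg _

lemma vRatio_nonneg (f : ℝ → ℝ) (t : ℝ) : 0 ≤ vRatio f t :=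
  div_nonneg (lam_sq_nonneg f t) (sq_nonneg _)

namespace IsIntegrand

lemma lam_nonneg (hf : IsIntegrand f) (t : ℝ) : 0 ≤ lam f t :=
  setIntegral_nonneg measurableSet_Ioc fun x hx => hf.nonneg x hx.1.le

lemma lam_mono (hf : IsIntegrand f) : Monotone (lam f) := fun _ t hst =>
  setIntegral_mono_set (hf.locallyIntegrable t)
    ((ae_restrict_iff' measurableSet_Ioc).2 (ae_of_all _ fun x hx => hf.nonneg x hx.1.le))
    (Ioc_subset_Ioc_right hst).eventuallyLE

lemma eventually_lam_pos (hf : IsIntegrand f) : ∀ᶠ t in atTop, 0 < lam f t := by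
  obtain ⟨t₀, ht₀⟩ := hf.nontrivial
  filter_upwards [eventually_ge_atTop t₀] with t ht using ht₀.trans_le (hf.lam_mono ht)

lemma const_mul (hc : 0 < c) (hf : IsIntegrand f) : IsIntegrand fun x => c * f x where
  nonneg x hx := mul_nonneg hc.le (hf.nonneg x hx)
  locallyIntegrable t := (hf.locallyIntegrable t).const_mul c
  nontrivial := hf.nontrivial.imp fun t ht => by
    rw [lam_const_mul]
    exact mul_pos hc ht

lemma add (hf : IsIntegrand f) (hg : IsIntegrand g) : IsIntegrand fun x => f x + g x where
  nonneg x hx := add_nonneg (hf.nonneg x hx) (hg.nonneg x hx)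
  locallyIntegrable t := (hf.locallyIntegrable t).add (hg.locallyIntegrable t)
  nontrivial := hf.nontrivial.imp fun t ht => by
    rw [lam_add (hf.locallyIntegrable t) (hg.locallyIntegrable t)]
    exact add_pos_of_pos_of_nonneg ht (hg.lam_nonneg t)

end IsIntegrand

lemma integrableOn_add_sq (hf : IntegrableOn f (Ioc 0 t)) (hg : IntegrableOn g (Ioc 0 t))
    (hf2 : IntegrableOn (fun x => f x ^ 2) (Ioc 0 t))
    (hg2 : IntegrableOn (fun x => g x ^ 2) (Ioc 0 t)) :
    IntegrableOn (fun x => (f x + g x) ^ 2) (Ioc 0 t) :=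
  (((memLp_two_iff_integrable_sq hf.aestronglyMeasurable).2 hf2).add
    ((memLp_two_iff_integrable_sq hg.aestronglyMeasurable).2 hg2)).integrable_sq

lemma vRatio_const_mul (hc : c ≠ 0) (f : ℝ → ℝ) : vRatio (fun x => c * f x) = vRatio f := by
  ext t
  simp only [vRatio, mul_pow, lam_const_mul]
  exact mul_div_mul_left _ _ (pow_ne_zero 2 hc)

lemma bRatio_const_mul (hc : c ≠ 0) (f : ℝ → ℝ) : bRatio (fun x => c * f x) = bRatio f := by
  ext t
  simp only [bRatio, lam_const_mul]
  exact mul_div_mul_left _ _ hc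

lemma vRatio_add_le (hf : IntegrableOn f (Ioc 0 t)) (hg : IntegrableOn g (Ioc 0 t))
    (hf2 : IntegrableOn (fun x => f x ^ 2) (Ioc 0 t))
    (hg2 : IntegrableOn (fun x => g x ^ 2) (Ioc 0 t)) (hft : 0 < lam f t) (hgt : 0 < lam g t) :
    vRatio (fun x => f x + g x) t ≤ 2 * vRatio f t + 2 * vRatio g t := by
  have hsq : lam (fun x => (f x + g x) ^ 2) t ≤
      2 * lam (fun x => f x ^ 2) t + 2 * lam (fun x => g x ^ 2) t := by
    rw [← lam_const_mul, ← lam_const_mul, ← lam_add (hf2.const_mul 2) (hg2.const_mul 2)]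
    exact lam_le_lam (integrableOn_add_sq hf hg hf2 hg2)
      ((hf2.const_mul 2).add (hg2.const_mul 2)) fun x => by
        nlinarith [sq_nonneg (f x - g x)]
  simp only [vRatio, lam_add hf hg]
  calc _ ≤ (2 * lam (fun x => f x ^ 2) t + 2 * lam (fun x => g x ^ 2) t)
        / (lam f t + lam g t) ^ 2 := by gcongr
    _ = 2 * (lam (fun x => f x ^ 2) t / (lam f t + lam g t) ^ 2)
        + 2 * (lam (fun x => g x ^ 2) t / (lam f t + lam g t) ^ 2) := by ring
    _ ≤ _ := by
      have := lam_sq_nonneg f t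
      have := lam_sq_nonneg g t
      gcongr
      · linarith
      · linarith

lemma bRatio_add_le (hf : IsIntegrand f) (hg : IsIntegrand g) (ht : 0 ≤ t)
    (hft : 0 < lam f t) (hgt : 0 < lam g t) :
    bRatio (fun x => f x + g x) t ≤ bRatio f t + bRatio g t := by
  simp only [bRatio, lam_add (hf.locallyIntegrable t) (hg.locallyIntegrable t), add_div]
  have := hf.nonneg t ht
  have := hg.nonneg t ht
  gcongr
  · linarith
  · linarith

lemma IsIntegrand.bRatio_nonneg (hf : IsIntegrand f) (ht : 0 ≤ t) : 0 ≤ bRatio f t :=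
  div_nonneg (hf.nonneg t ht) (hf.lam_nonneg t)

end Integrands

/-! ### The classes `𝒱` and `ℬ` and the divergent integrands -/

theorem closedUnderScalingAndSums_classV : ClosedUnderScalingAndSums ClassV := by
  refine ⟨fun c hc f hf => ⟨hf.1.const_mul hc, fun t => ?_, ?_⟩,
    fun f hf g hg => ⟨hf.1.add hg.1, fun t => ?_, ?_⟩⟩
  · simp only [mul_pow]
    exact (hf.2.1 t).const_mul _
  · rw [vRatio_const_mul hc.ne']
    exact hf.2.2
  · exact integrableOn_add_sq (hf.1.locallyIntegrable t) (hg.1.locallyIntegrable t) (hf.2.1 t)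
      (hg.2.1 t)
  · have hlim : Tendsto (fun t => 2 * vRatio f t + 2 * vRatio g t) atTop (𝓝 0) := by
      simpa using (hf.2.2.const_mul 2).add (hg.2.2.const_mul 2)
    refine tendsto_of_tendsto_of_tendsto_of_le_of_le' tendsto_const_nhds hlim
      (Eventually.of_forall fun t => vRatio_nonneg _ t) ?_
    filter_upwards [hf.1.eventually_lam_pos, hg.1.eventually_lam_pos] with t hft hgt
    exact vRatio_add_le (hf.1.locallyIntegrable t) (hg.1.locallyIntegrable t) (hf.2.1 t)
      (hg.2.1 t) hft hgt

theorem closedUnderScalingAndSums_classB : ClosedUnderScalingAndSums ClassB := by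
  refine ⟨fun c hc f hf => ⟨hf.1.const_mul hc, ?_⟩, fun f hf g hg => ⟨hf.1.add hg.1, ?_⟩⟩
  · rw [bRatio_const_mul hc.ne']
    exact hf.2
  · have hlim : Tendsto (fun t => bRatio f t + bRatio g t) atTop (𝓝 0) := by
      simpa using hf.2.add hg.2
    refine tendsto_of_tendsto_of_tendsto_of_le_of_le' tendsto_const_nhds hlim ?_ ?_
    · filter_upwards [eventually_ge_atTop 0] with t ht using (hf.1.add hg.1).bRatio_nonneg ht
    · filter_upwards [eventually_ge_atTop 0, hf.1.eventually_lam_pos,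
        hg.1.eventually_lam_pos] with t ht hft hgt
      exact bRatio_add_le hf.1 hg.1 ht hft hgt

theorem closedUnderScalingAndSums_divergent : ClosedUnderScalingAndSums Divergent := by
  refine ⟨fun c hc f hf => ⟨hf.1.const_mul hc, ?_⟩, fun f hf g hg => ⟨hf.1.add hg.1, ?_⟩⟩
  · exact (hf.2.const_mul_atTop hc).congr fun t => (lam_const_mul c f t).symm
  · exact (tendsto_atTop_mono (fun t => le_add_of_nonneg_right (hg.1.lam_nonneg t)) hf.2).congr fun t =>
      (lam_add (hf.1.locallyIntegrable t) (hg.1.locallyIntegrable t)).symm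

lemma ClosedUnderScalingAndSums.inter {C D : Set (ℝ → ℝ)} (hC : ClosedUnderScalingAndSums C)
    (hD : ClosedUnderScalingAndSums D) : ClosedUnderScalingAndSums (C ∩ D) :=
  ⟨fun c hc f hf => ⟨hC.1 c hc f hf.1, hD.1 c hc f hf.2⟩,
    fun f hf g hg => ⟨hC.2 f hf.1 g hg.1, hD.2 f hf.2 g hg.2⟩⟩

/-! ### The mean of the Gamma law -/

/-- Size-biasing raises the shape by one, because Γ(a + 1) = a Γ(a). The mean then follows from the
normalisation of the density of shape a + 1. -/
lemma ofReal_mul_gammaPDF {a : ℝ} (ha : 0 < a) (x : ℝ) :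
    gammaPDF a 1 x * ENNReal.ofReal x = ENNReal.ofReal a * gammaPDF (a + 1) 1 x := by
  rcases lt_or_ge x 0 with hx | hx
  · simp [gammaPDF_of_neg hx]
  · rw [gammaPDF_of_nonneg hx, gammaPDF_of_nonneg hx, ← ENNReal.ofReal_mul' hx,
      ← ENNReal.ofReal_mul ha.le, Real.Gamma_add_one ha.ne', add_sub_cancel_right]
    have hG := (Real.Gamma_pos_of_pos ha).ne'
    congr 1
    -- At x = 0 the factor x kills the left side, even where x^(a-1) is singular, and 0^a = 0 kills
    -- the right.
    rcases hx.eq_or_lt with rfl | hx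
    · simp [Real.zero_rpow ha.ne']
    · rw [Real.rpow_sub_one hx.ne']
      simp only [Real.one_rpow]
      field_simp

lemma lintegral_ofReal_gammaMeasure {a : ℝ} (ha : 0 < a) :
    ∫⁻ x, ENNReal.ofReal x ∂gammaMeasure a 1 = ENNReal.ofReal a := by
  have hpdf (b : ℝ) : Measurable (gammaPDF b 1) :=
    (measurable_gammaPDFReal b 1).ennreal_ofReal
  rw [gammaMeasure, lintegral_withDensity_eq_lintegral_mul _ (hpdf a) ENNReal.measurable_ofReal]
  simp only [Pi.mul_apply, ofReal_mul_gammaPDF ha]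
  rw [lintegral_const_mul _ (hpdf _), lintegral_gammaPDF_eq_one (by linarith) one_pos, mul_one]

/-! ### The intensity of the random measure `dΓ` -/

instance (γ : ℝ≥0 → ℝ) : IsLocallyFiniteMeasure (pathMeasure γ) := by
  unfold pathMeasure
  split_ifs <;> infer_instance

lemma pathMeasure_Ioc {γ : ℝ≥0 → ℝ} (h : IsGoodPath γ) (a b : ℝ) :
    pathMeasure γ (Ioc a b) = ENNReal.ofReal (γ b.toNNReal - γ a.toNNReal) := by
  rw [pathMeasure, dif_pos h, StieltjesFunction.measure_Ioc]
  rfl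

/-- The increments of Γ are only a.e. measurable. Over the completion of P they become measurable,
and their laws do not change. -/
lemma map_completion {Ω E : Type*} [MeasurableSpace Ω] [MeasurableSpace E] {P : Measure Ω}
    {X : Ω → E} (hX : AEMeasurable X P) :
    P.completion.map (fun ω : NullMeasurableSpace Ω P => X ω) = P.map X := by
  have hX' : Measurable fun ω : NullMeasurableSpace Ω P => X ω := hX.nullMeasurable
  ext s hs
  rw [Measure.map_apply hX' hs, Measure.map_apply_of_aemeasurable hX hs]
  rfl

namespace IsGammaProcess

variable {Ω : Type*} [MeasurableSpace Ω] {P : Measure Ω} {Γ : ℝ≥0 → Ω → ℝ}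

lemma ae_pathMeasure_Ioc (hΓ : IsGammaProcess P Γ) (a b : ℝ) :
    (fun ω => ENNReal.ofReal (Γ b.toNNReal ω - Γ a.toNNReal ω)) =ᵐ[P]
      fun ω => pathMeasure (fun s => Γ s ω) (Ioc a b) :=
  hΓ.path.mono fun _ hω => (pathMeasure_Ioc hω a b).symm

lemma aemeasurable_pathMeasure_Ioc (hΓ : IsGammaProcess P Γ) {a : ℝ} (ha : 0 ≤ a) (b : ℝ) :
    AEMeasurable (fun ω => pathMeasure (fun s => Γ s ω) (Ioc a b)) P := by
  rcases le_or_gt b a with hab | hab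
  · simp [Ioc_eq_empty hab.not_gt]
  · have hlaw := hΓ.law _ _ ((Real.toNNReal_lt_toNNReal_iff_of_nonneg ha).2 hab)
    exact hlaw.aemeasurable.ennreal_ofReal.congr (hΓ.ae_pathMeasure_Ioc a b)

/-- This is the mean of the Gamma law of shape b - a. The condition 0 ≤ a matters: dΓ has no mass on
the negative axis. -/
lemma lintegral_pathMeasure_Ioc (hΓ : IsGammaProcess P Γ) {a : ℝ} (ha : 0 ≤ a) (b : ℝ) :
    ∫⁻ ω, pathMeasure (fun s => Γ s ω) (Ioc a b) ∂P.completion = ENNReal.ofReal (b - a) := by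
  rcases le_or_gt b a with hab | hab
  · simp [Ioc_eq_empty hab.not_gt, ENNReal.ofReal_of_nonpos (sub_nonpos.2 hab)]
  have hlaw := hΓ.law _ _ ((Real.toNNReal_lt_toNNReal_iff_of_nonneg ha).2 hab)
  rw [Real.coe_toNNReal _ ha, Real.coe_toNNReal _ (ha.trans hab.le)] at hlaw
  have hX : Measurable (fun ω : NullMeasurableSpace Ω P => Γ b.toNNReal ω - Γ a.toNNReal ω) :=
    hlaw.aemeasurable.nullMeasurable
  calc ∫⁻ ω, pathMeasure (fun s => Γ s ω) (Ioc a b) ∂P.completion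
      = ∫⁻ ω, ENNReal.ofReal (Γ b.toNNReal ω - Γ a.toNNReal ω) ∂P.completion :=
        lintegral_congr_ae (hΓ.ae_pathMeasure_Ioc a b).symm
    _ = ∫⁻ x, ENNReal.ofReal x ∂gammaMeasure (b - a) 1 := by
        rw [← hlaw.map_eq, ← map_completion hlaw.aemeasurable,
          lintegral_map ENNReal.measurable_ofReal hX]
    _ = ENNReal.ofReal (b - a) := lintegral_ofReal_gammaMeasure (sub_pos.2 hab)

/-- Restriction to (0, t] makes the measures finite, so half-open intervals, a π-system, suffice.
Their left endpoints become a ⊔ 0 ≥ 0. -/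
lemma measurable_restrict_pathMeasure (hΓ : IsGammaProcess P Γ) (t : ℝ) :
    Measurable fun ω : NullMeasurableSpace Ω P =>
      (pathMeasure (fun s => Γ s ω)).restrict (Ioc 0 t) := by
  have hfin (ω : NullMeasurableSpace Ω P) :
      IsFiniteMeasure ((pathMeasure (fun s => Γ s ω)).restrict (Ioc 0 t)) :=
    isFiniteMeasure_restrict.2 measure_Ioc_lt_top.ne
  refine Measurable.measure_of_isPiSystem
    (BorelSpace.measurable_eq.trans (borel_eq_generateFrom_Ioc ℝ)) (isPiSystem_Ioc id id) ?_ ?_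
  · rintro _ ⟨a, b, -, rfl⟩
    simp only [Measure.restrict_apply measurableSet_Ioc, Ioc_inter_Ioc]
    exact (hΓ.aemeasurable_pathMeasure_Ioc le_sup_right _).nullMeasurable
  · simp only [Measure.restrict_apply_univ]
    exact (hΓ.aemeasurable_pathMeasure_Ioc le_rfl _).nullMeasurable

/-- The intensity measure of `dΓ` is Lebesgue measure. -/
lemma bind_restrict_pathMeasure (hΓ : IsGammaProcess P Γ) (t : ℝ) :
    P.completion.bind (fun ω => (pathMeasure (fun s => Γ s ω)).restrict (Ioc 0 t)) =
      volume.restrict (Ioc 0 t) := by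
  have hκ := (hΓ.measurable_restrict_pathMeasure t).aemeasurable (μ := P.completion)
  have hIoc (a b : ℝ) :
      P.completion.bind (fun ω => (pathMeasure (fun s => Γ s ω)).restrict (Ioc 0 t)) (Ioc a b) =
        volume.restrict (Ioc 0 t) (Ioc a b) := by
    rw [Measure.bind_apply measurableSet_Ioc hκ]
    simp only [Measure.restrict_apply measurableSet_Ioc, Ioc_inter_Ioc]
    rw [hΓ.lintegral_pathMeasure_Ioc le_sup_right, Real.volume_Ioc]
  have huniv :
      P.completion.bind (fun ω => (pathMeasure (fun s => Γ s ω)).restrict (Ioc 0 t)) univ =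
        volume.restrict (Ioc 0 t) univ := by
    rw [Measure.bind_apply MeasurableSet.univ hκ]
    simp only [Measure.restrict_apply_univ]
    rw [hΓ.lintegral_pathMeasure_Ioc le_rfl, Real.volume_Ioc]
  refine (ext_of_generate_finite _
    (BorelSpace.measurable_eq.trans (borel_eq_generateFrom_Ioc ℝ)) (isPiSystem_Ioc id id)
    ?_ huniv.symm).symm
  rintro _ ⟨a, b, -, rfl⟩
  exact (hIoc a b).symm

lemma ae_integrableOn (hΓ : IsGammaProcess P Γ) {f : ℝ → ℝ} {t : ℝ}
    (hf : IntegrableOn f (Ioc 0 t)) :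
    ∀ᵐ ω ∂P, IntegrableOn f (Ioc 0 t) (pathMeasure fun s => Γ s ω) := by
  have hκ := (hΓ.measurable_restrict_pathMeasure t).aemeasurable (μ := P.completion)
  rw [IntegrableOn, ← hΓ.bind_restrict_pathMeasure t] at hf
  -- f is only Lebesgue-a.e. measurable; a Lebesgue-null set in (0, t] is dΓ-null for almost every
  -- path.
  have hmeas := hκ.ae_of_bind hf.aestronglyMeasurable.aemeasurable
  have hlint := hf.hasFiniteIntegral
  rw [HasFiniteIntegral, Measure.lintegral_bind hκ hf.aestronglyMeasurable.enorm] at hlint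
  -- Measurability of ω ↦ ∫ |f| dΓ is obtained through a measurable version of f.
  have hm := (Measure.measurable_lintegral (measurable_enorm.comp
    hf.aestronglyMeasurable.aemeasurable.measurable_mk)).comp_aemeasurable hκ
  have hfin : ∀ᵐ ω : NullMeasurableSpace Ω P ∂P.completion,
      ∫⁻ x in Ioc 0 t, ‖f x‖ₑ ∂(pathMeasure fun s => Γ s ω) < ∞ := by
    refine ae_lt_top' (hm.congr ?_) hlint.ne
    filter_upwards [Measure.ae_ae_of_ae_bind hκ
      hf.aestronglyMeasurable.aemeasurable.ae_eq_mk] with ω hω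
    exact lintegral_congr_ae (hω.mono fun x hx => by simp [hx])
  rw [Measure.ae_completion] at hmeas hfin
  filter_upwards [hmeas, hfin] with ω h₁ h₂
  exact ⟨h₁.aestronglyMeasurable, h₂⟩

lemma ae_gammaIntegral_add (hΓ : IsGammaProcess P Γ) {f g : ℝ → ℝ} {t : ℝ}
    (hf : IntegrableOn f (Ioc 0 t)) (hg : IntegrableOn g (Ioc 0 t)) :
    ∀ᵐ ω ∂P, gammaIntegral Γ (fun x => f x + g x) t ω =
      gammaIntegral Γ f t ω + gammaIntegral Γ g t ω := by
  filter_upwards [hΓ.ae_integrableOn hf, hΓ.ae_integrableOn hg] with ω h₁ h₂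
  exact integral_add h₁ h₂

end IsGammaProcess

/-! ### Orderly divergence -/

lemma abs_add_div_add_sub_one_lt {x y a b ε : ℝ} (ha : 0 < a) (hb : 0 < b)
    (hx : |x / a - 1| < ε) (hy : |y / b - 1| < ε) : |(x + y) / (a + b) - 1| < ε := by
  have hab : 0 < a + b := add_pos ha hb
  rw [div_sub_one ha.ne', abs_div, abs_of_pos ha, div_lt_iff₀ ha] at hx
  rw [div_sub_one hb.ne', abs_div, abs_of_pos hb, div_lt_iff₀ hb] at hy
  rw [div_sub_one hab.ne', abs_div, abs_of_pos hab, div_lt_iff₀ hab]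
  calc |x + y - (a + b)| = |(x - a) + (y - b)| := by ring_nf
    _ ≤ |x - a| + |y - b| := abs_add_le _ _
    _ < ε * (a + b) := by linarith

theorem closedUnderScalingAndSums_classOD {Ω : Type*} [MeasurableSpace Ω] {P : Measure Ω}
    {Γ : ℝ≥0 → Ω → ℝ} (hΓ : IsGammaProcess P Γ) :
    ClosedUnderScalingAndSums (ClassOD P Γ) := by
  refine ⟨fun c hc f hf => ⟨closedUnderScalingAndSums_divergent.1 c hc f hf.1, ?_⟩,
    fun f hf g hg => ⟨closedUnderScalingAndSums_divergent.2 f hf.1 g hg.1, ?_⟩⟩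
  -- Scaling holds for every ω: without integrability both integrals are 0 by convention.
  · have h (t : ℝ) (ω : Ω) : gammaIntegral Γ (fun x => c * f x) t ω / lam (fun x => c * f x) t =
        gammaIntegral Γ f t ω / lam f t := by
      rw [lam_const_mul, gammaIntegral, integral_const_mul]
      exact mul_div_mul_left _ _ hc.ne'
    simpa only [h] using hf.2
  · have hfP := hf.2
    have hgP := hg.2
    rw [tendstoInMeasure_iff_dist] at hfP hgP ⊢
    intro ε hε
    have hlim := (hfP ε hε).add (hgP ε hε)
    rw [add_zero] at hlim
    refine tendsto_of_tendsto_of_tendsto_of_le_of_le' tendsto_const_nhds hlim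
      (Eventually.of_forall fun _ => zero_le) ?_
    filter_upwards [hf.1.1.eventually_lam_pos, hg.1.1.eventually_lam_pos] with t hft hgt
    -- Additivity of the Gamma integral is only almost sure, so the inclusion of events holds up to
    -- a null set.
    refine (measure_mono_ae ?_).trans (measure_union_le _ _)
    filter_upwards [hΓ.ae_gammaIntegral_add (hf.1.1.locallyIntegrable t)
      (hg.1.1.locallyIntegrable t)] with ω hω hmem
    by_contra hnot
    have h₁ : ¬ε ≤ dist (gammaIntegral Γ f t ω / lam f t) 1 := fun h => hnot (Or.inl h)
    have h₂ : ¬ε ≤ dist (gammaIntegral Γ g t ω / lam g t) 1 := fun h => hnot (Or.inr h)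
    rw [Real.dist_eq, not_le] at h₁ h₂
    have hle : ε ≤ dist (gammaIntegral Γ (fun x => f x + g x) t ω /
        lam (fun x => f x + g x) t) 1 := hmem
    rw [hω, lam_add (hf.1.1.locallyIntegrable t) (hg.1.1.locallyIntegrable t),
      Real.dist_eq] at hle
    exact hle.not_gt (abs_add_div_add_sub_one_lt hft hgt h₁ h₂)

end OrderlyDivergence

theorem mainTheorem9 :
    OrderlyDivergence.ClosedUnderScalingAndSums OrderlyDivergence.ClassV ∧
    OrderlyDivergence.ClosedUnderScalingAndSums OrderlyDivergence.ClassB ∧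
    OrderlyDivergence.ClosedUnderScalingAndSums
      (OrderlyDivergence.ClassB ∩ OrderlyDivergence.Divergent) ∧
    ∀ (Ω : Type*) [MeasurableSpace Ω] (P : Measure Ω) [IsProbabilityMeasure P]
      (Γ : ℝ≥0 → Ω → ℝ), OrderlyDivergence.IsGammaProcess P Γ →
      OrderlyDivergence.ClosedUnderScalingAndSums (OrderlyDivergence.ClassOD P Γ) :=
  ⟨OrderlyDivergence.closedUnderScalingAndSums_classV,
    OrderlyDivergence.closedUnderScalingAndSums_classB,
    OrderlyDivergence.closedUnderScalingAndSums_classB.inter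
      OrderlyDivergence.closedUnderScalingAndSums_divergent,
    fun _ _ _ _ _ hΓ => OrderlyDivergence.closedUnderScalingAndSums_classOD hΓ⟩
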